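/- Let $G_m^n$ ($m,n\ge 1$) be the Bollobás–Riordan preferential attachment multigraph on the vertex set $\{1,\dots,n\}$: starting from the empty graph, the vertices $t=1,2,\dots,n$ arrive one after another, and $m$ edges emanating from $t$ are added one at a time; the other end of each of these edges is chosen at random among $1,\dots,t$ with probability proportional to the current vertex degrees, where the previously added edges and also the "outward half" (at $t$) of the edge being added already contribute to the degrees. Loops and parallel edges are allowed, and a loop contributes $2$ to the degree of its vertex. Let $D(j)$ denote the degree of vertex $j$ in $G_m^n$. 1. For every $\sigma\in(0,1)$ the equation $$(1-\sigma)^{-1/2}-1=\frac1{z\log z+1-z}$$ has a unique root $z=z(\sigma)$ in $(1,\infty)$, and $z(\sigma)\sim \dfrac{2}{\sigma\log(1/\sigma)}$ as $\sigma\to0^+$. 2. Fix $m\ge 1$, $a\in\bigl(0,\tfrac{m}{m+2}\bigr)$ and let $j_n=\lfloor n^a\rfloor$. For every $\sigma\in(0,1)$ and every $z>z(\sigma)$, $$\lim_{n\to\infty}\mathbb P\Bigl(D(j)\le z\bigl((n/j)^{1/2}-1\bigr)\log n\ \text{ for all integers } j\in[j_n,(1-\sigma)n]\Bigr)=1 .$$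 3. Consequently the vertices in the bulk have degrees of at most logarithmic order: for all $\varepsilon,\sigma\in(0,1)$ there is a constant $C=C(\varepsilon,\sigma)>0$ such that for every $m\ge 1$ $$\lim_{n\to\infty}\mathbb P\bigl(D(j)\le C\log n\ \text{ for all integers } j\in[\varepsilon n,(1-\sigma)n]\bigr)=1 .$$ -/

import Mathlib

open Filter Topology Asymptotics

noncomputable section

/-- A finite multigraph on (part of) the positive integers, given by its multiset of edges.
Loops `s(v, v)` and parallel edges are allowed. -/
abbrev Multigraph : Type := Multiset (Sym2 ℕ)

namespace Multigraph

/-- The multiset of endpoints of all the edges; a loop at `v` contributes `v` twice. -/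
def halfEdges (E : Multigraph) : Multiset ℕ := E.bind Sym2.toMultiset

/-- The degree of `v`: a loop at `v` counts twice, parallel edges count separately. -/
def degree (E : Multigraph) (v : ℕ) : ℕ := E.halfEdges.count v

/-- The other end of an edge emanating from the vertex `t`, when the current multigraph is `E`:
a vertex `s` is chosen with probability proportional to its degree in `E`, where the outward half
of the new edge already counts as contributing `1` to the degree of `t`
(see `attach_apply`). -/
def attach (E : Multigraph) (t : ℕ) : PMF ℕ :=
  PMF.ofMultiset (t ::ₘ E.halfEdges) Multiset.cons_ne_zero

theorem attach_apply (E : Multigraph) (t s : ℕ) :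
    E.attach t s =
      ((E.degree s + if s = t then 1 else 0 : ℕ) : ENNReal) / ((2 * Multiset.card E + 1 : ℕ)) := by
  have h : ∀ F : Multigraph, Multiset.card (halfEdges F) = 2 * Multiset.card F := by
    intro F
    induction F using Multiset.induction_on with
    | empty => simp [halfEdges]
    | cons e F ih =>
      simp only [halfEdges, Multiset.cons_bind, Multiset.card_add, Multiset.card_cons] at ih ⊢
      rw [ih, Sym2.card_toMultiset]
      ring
  rw [attach, PMF.ofMultiset_apply, Multiset.card_cons, h, degree, ← Multiset.count_cons]
  congr!

end Multigraph

/-- The law of the preferential attachment multigraph with `m` edges per vertex after `i` edges have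
been added, one at a time: the first `m` edges emanate from the vertex `1`, the next `m` edges from
the vertex `2`, and so on, the edge number `i + 1` emanating from the vertex `i / m + 1`. -/
def attachmentProcess (m : ℕ) : ℕ → PMF Multigraph
  | 0 => PMF.pure 0
  | i + 1 => (attachmentProcess m i).bind fun E =>
      (E.attach (i / m + 1)).map fun s => s(s, i / m + 1) ::ₘ E

/-- The law of the random multigraph `G_m^n` with vertex set `{1, …, n}` (for `m ≥ 1`). -/
def prefAttachGraph (m n : ℕ) : PMF Multigraph := attachmentProcess m (m * n)

/-- `φ(z) = 1 / (z log z + 1 - z)`, used for `z > 1`, where the denominator is positive. -/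
def phi (z : ℝ) : ℝ := (z * Real.log z + 1 - z)⁻¹

end

noncomputable section

/-! The degree bound is a Chernoff bound. When an edge from another vertex joins a graph with `i`
edges, the conditional mean of `u ^ D(j)` is at most `u' ^ D(j)` with `u' = u(1 + (u-1)/(2i+1))`. In
the coordinate `u = 1/(1-w)` this recursion is controlled by `w = θ√(mj/i)`. Running it back to time
`mj`, where `D(j) ≤ 2m`, gives `P(D(j) > k) ≤ (1-θ)^(-2m) (1-θx)^k` with `x = √(j/n)`
(`toOuterMeasure_lt_degree_le`).

For `k = z(1/x-1) log n` the bound is a constant times `n^(-z * rate θ x)`. By `rate_anti` the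
largest `x`, namely `√(1-σ)`, is the worst. There `z * rate 1 x > 1` as soon as `z > z(σ)`, by
`one_le_mul_phi_mul_log`; this persists for some `θ < 1`, and a union bound over at most `n`
vertices finishes.

The root exists and is unique because `z log z + 1 - z` increases from 0 to infinity on `[1, ∞)`;
its asymptotics come from inverting `z log z ~ 2/σ`. -/

theorem PMF.tsum_bind_mul {α β : Type*} (p : PMF α) (q : α → PMF β) (f : β → ENNReal) :
    ∑' b, p.bind q b * f b = ∑' a, p a * ∑' b, q a b * f b := by
  simp only [PMF.bind_apply, ← ENNReal.tsum_mul_right, ← ENNReal.tsum_mul_left]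
  rw [ENNReal.tsum_comm]
  simp only [mul_assoc]

theorem PMF.tsum_map_mul {α β : Type*} (p : PMF α) (g : α → β) (f : β → ENNReal) :
    ∑' b, p.map g b * f b = ∑' a, p a * f (g a) := by
  rw [PMF.map, PMF.tsum_bind_mul]
  refine tsum_congr fun a => ?_
  congr 1
  rw [tsum_eq_single (g a)]
  · simp
  · intro b hb
    simp [hb]

theorem PMF.toOuterMeasure_le_mul_le {α : Type*} (p : PMF α) (f : α → ENNReal) (c : ENNReal) :
    p.toOuterMeasure {a | c ≤ f a} * c ≤ ∑' a, p a * f a := by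
  rw [PMF.toOuterMeasure_apply, ← ENNReal.tsum_mul_right]
  refine ENNReal.tsum_le_tsum fun a => ?_
  by_cases h : a ∈ {a | c ≤ f a}
  · rw [Set.indicator_of_mem h]
    gcongr
    exact h
  · simp [Set.indicator_of_notMem h]

theorem PMF.toOuterMeasure_le_one {α : Type*} (p : PMF α) (s : Set α) :
    p.toOuterMeasure s ≤ 1 := by
  rw [PMF.toOuterMeasure_apply, ← p.tsum_coe]
  exact ENNReal.tsum_le_tsum fun a => Set.indicator_le_self _ _ _

theorem PMF.one_sub_toOuterMeasure_compl_le {α : Type*} (p : PMF α) (s : Set α) :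
    1 - p.toOuterMeasure sᶜ ≤ p.toOuterMeasure s := by
  rw [tsub_le_iff_right]
  calc (1 : ENNReal) = p.toOuterMeasure Set.univ := by simp [PMF.toOuterMeasure_apply]
    _ = p.toOuterMeasure (s ∪ sᶜ) := by rw [Set.union_compl_self]
    _ ≤ _ := MeasureTheory.measure_union_le _ _

/-! ### Adding a single edge -/

namespace Multigraph

theorem degree_cons (E : Multigraph) (s t v : ℕ) :
    degree (s(s, t) ::ₘ E) v =
      degree E v + ((if v = s then 1 else 0) + if v = t then 1 else 0) := by
  have : Sym2.toMultiset s(s, t) = {s, t} := rfl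
  simp only [degree, halfEdges, Multiset.cons_bind, Multiset.count_add, this,
    Multiset.insert_eq_cons, Multiset.count_cons, Multiset.count_singleton]
  ring

/-- The exact mean is `u^d (1 + d(u-1)/(2|E|+1))`; Bernoulli's inequality makes it a pure `d`-th
power, so that the estimate can be iterated. -/
theorem tsum_attach_mul_pow_degree (E : Multigraph) {t j : ℕ} (htj : j ≠ t) {u : ℝ}
    (hu : 1 ≤ u) :
    ∑' s, E.attach t s * ENNReal.ofReal (u ^ degree (s(s, t) ::ₘ E) j) ≤
      ENNReal.ofReal ((u * (1 + (u - 1) / (2 * Multiset.card E + 1))) ^ E.degree j) := by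
  have hu0 : 0 ≤ u := by linarith
  have hv : 0 ≤ u - 1 := by linarith
  set d := E.degree j with hd
  have h1 : ∀ s, E.attach t s * ENNReal.ofReal (u ^ degree (s(s, t) ::ₘ E) j) =
      E.attach t s * ENNReal.ofReal (u ^ d) +
        if s = j then E.attach t j * ENNReal.ofReal ((u - 1) * u ^ d) else 0 := by
    intro s
    rw [degree_cons, if_neg htj, add_zero]
    split_ifs with h h' h'
    · subst h
      rw [← mul_add, ← ENNReal.ofReal_add (by positivity) (by positivity), pow_succ]
      congr 2
      ring
    · exact absurd h.symm h'
    · exact absurd h'.symm h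
    · simp [hd]
  simp_rw [h1]
  rw [ENNReal.tsum_add, ENNReal.tsum_mul_right, PMF.tsum_coe, one_mul, tsum_ite_eq, attach_apply,
    if_neg htj, add_zero, ← hd]
  have hc : (0 : ℝ) < 2 * Multiset.card E + 1 := by positivity
  have h2 : ((d : ℕ) : ENNReal) / ((2 * Multiset.card E + 1 : ℕ) : ENNReal) =
      ENNReal.ofReal (d / (2 * Multiset.card E + 1)) := by
    rw [ENNReal.ofReal_div_of_pos hc, ENNReal.ofReal_natCast]
    congr 1
    rw [← ENNReal.ofReal_natCast]
    push_cast
    rfl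
  rw [h2, ← ENNReal.ofReal_mul (by positivity), ← ENNReal.ofReal_add (by positivity)
    (by positivity)]
  refine ENNReal.ofReal_le_ofReal ?_
  have h3 := one_add_mul_le_pow (a := (u - 1) / (2 * Multiset.card E + 1))
    (by have : 0 ≤ (u - 1) / (2 * Multiset.card E + 1) := by positivity
        linarith) d
  rw [mul_pow]
  calc u ^ d + d / (2 * Multiset.card E + 1) * ((u - 1) * u ^ d)
      = u ^ d * (1 + d * ((u - 1) / (2 * Multiset.card E + 1))) := by ring
    _ ≤ _ := by gcongr

theorem eq_or_degree_pos_of_mem_support_attach {E : Multigraph} {t s : ℕ}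
    (h : s ∈ (E.attach t).support) : s = t ∨ 0 < E.degree s := by
  rw [PMF.mem_support_iff, attach_apply] at h
  by_contra! hn
  have : E.degree s = 0 := by omega
  simp [this, hn.1] at h

end Multigraph

open Multigraph

/-! ### Generating function of a degree along the process -/

theorem mem_support_attachmentProcess_succ {m i : ℕ} {G : Multigraph}
    (hG : G ∈ (attachmentProcess m (i + 1)).support) :
    ∃ E ∈ (attachmentProcess m i).support, ∃ s ∈ (E.attach (i / m + 1)).support,
      G = s(s, i / m + 1) ::ₘ E := by
  rw [attachmentProcess, PMF.mem_support_bind_iff] at hG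
  obtain ⟨E, hE, hG⟩ := hG
  rw [PMF.mem_support_map_iff] at hG
  obtain ⟨s, hs, rfl⟩ := hG
  exact ⟨E, hE, s, hs, rfl⟩

theorem card_of_mem_support_attachmentProcess {m i : ℕ} {G : Multigraph}
    (hG : G ∈ (attachmentProcess m i).support) : Multiset.card G = i := by
  induction i generalizing G with
  | zero =>
    rw [attachmentProcess, PMF.mem_support_pure_iff] at hG
    simp [hG]
  | succ i ih =>
    obtain ⟨E, hE, s, -, rfl⟩ := mem_support_attachmentProcess_succ hG
    rw [Multiset.card_cons, ih hE]

/-- Truncated subtraction encodes degree 0 before the vertex arrives, as an absent vertex is never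
chosen; afterwards each edge adds at most 2. -/
theorem degree_le_of_mem_support_attachmentProcess {m i j : ℕ} (hm : 1 ≤ m) {G : Multigraph}
    (hG : G ∈ (attachmentProcess m i).support) : G.degree (j + 1) ≤ 2 * (i - m * j) := by
  induction i generalizing G with
  | zero =>
    rw [attachmentProcess, PMF.mem_support_pure_iff] at hG
    simp [hG, degree, halfEdges]
  | succ i ih =>
    obtain ⟨E, hE, s, hs, rfl⟩ := mem_support_attachmentProcess_succ hG
    have hd := ih hE
    rw [degree_cons]
    rcases le_or_gt (m * j) i with h | h
    · split_ifs <;> omega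
    · have ht : i / m < j := by rwa [Nat.div_lt_iff_lt_mul hm, mul_comm]
      have h0 : E.degree (j + 1) = 0 := by omega
      have hsj : j + 1 ≠ s := by
        rintro rfl
        rcases eq_or_degree_pos_of_mem_support_attach hs with h' | h' <;> omega
      rw [if_neg hsj, if_neg (by omega), h0]
      omega

theorem tsum_attachmentProcess_succ_le {m i j : ℕ} (hij : j < i / m + 1) {u u' : ℝ}
    (hu : 1 ≤ u) (huu : u * (1 + (u - 1) / (2 * i + 1)) ≤ u') :
    ∑' G, attachmentProcess m (i + 1) G * ENNReal.ofReal (u ^ G.degree j) ≤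
      ∑' G, attachmentProcess m i G * ENNReal.ofReal (u' ^ G.degree j) := by
  rw [attachmentProcess, PMF.tsum_bind_mul]
  refine ENNReal.tsum_le_tsum fun E => ?_
  by_cases hE : attachmentProcess m i E = 0
  · simp [hE]
  gcongr
  rw [PMF.tsum_map_mul]
  refine (tsum_attach_mul_pow_degree E hij.ne hu).trans ?_
  rw [card_of_mem_support_attachmentProcess ((PMF.mem_support_iff _ _).2 hE)]
  refine ENNReal.ofReal_le_ofReal ?_
  gcongr

/-- Linearizes the recursion for `u = 1/(1-w)`. After clearing denominators it is `(1-w+wp)(1-w-wp)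
≤ (1-w)^2`. -/
theorem inv_one_sub_mul_le {w w' p : ℝ} (hw : 0 ≤ w) (hp : 0 ≤ p) (hw' : w' < 1)
    (hww : w * (1 + p) ≤ w') :
    (1 - w)⁻¹ * (1 + ((1 - w)⁻¹ - 1) * p) ≤ (1 - w')⁻¹ := by
  have hwp : 0 ≤ w * p := by positivity
  have h1 : 0 < 1 - w := by nlinarith
  have h2 : 0 < 1 - w * (1 + p) := by linarith
  refine le_trans ?_ (inv_anti₀ (by linarith) (by linarith : 1 - w' ≤ 1 - w * (1 + p)))
  have : (1 - w)⁻¹ * (1 + ((1 - w)⁻¹ - 1) * p) = (1 - w + w * p) / (1 - w) ^ 2 := by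
    field_simp
    ring
  rw [this, ← one_div, div_le_div_iff₀ (by positivity) h2]
  nlinarith [sq_nonneg (w * p)]

/-- Reduces to `4i(i+1) ≤ (2i+1)^2`; this is where the exponent 1/2 comes from. -/
theorem sqrt_div_step {a i : ℝ} (ha : 0 ≤ a) (hi : 0 < i) :
    √(a / (i + 1)) * (1 + 1 / (2 * i + 1)) ≤ √(a / i) := by
  refine Real.le_sqrt_of_sq_le ?_
  rw [mul_pow, Real.sq_sqrt (by positivity)]
  have : (1 + 1 / (2 * i + 1)) ^ 2 ≤ (i + 1) / i := by
    rw [le_div_iff₀ hi, show 1 + 1 / (2 * i + 1) = (2 * i + 2) / (2 * i + 1) by field_simp; ring,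
      div_pow, div_mul_eq_mul_div, div_le_iff₀ (by positivity)]
    nlinarith
  calc a / (i + 1) * (1 + 1 / (2 * i + 1)) ^ 2 ≤ a / (i + 1) * ((i + 1) / i) := by gcongr
    _ = a / i := by field_simp

theorem tsum_attachmentProcess_mul_pow_degree_le {m j : ℕ} (hm : 1 ≤ m) (hj : 1 ≤ j) {θ : ℝ}
    (hθ0 : 0 ≤ θ) (hθ : θ < 1) {i : ℕ} (hi : m * j ≤ i) :
    ∑' G, attachmentProcess m i G *
        ENNReal.ofReal (((1 - θ * √((m * j : ℕ) / i))⁻¹) ^ G.degree j) ≤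
      ENNReal.ofReal (((1 - θ)⁻¹) ^ (2 * m)) := by
  have hmj : 0 < m * j := by positivity
  induction i, hi using Nat.le_induction with
  | base =>
    rw [div_self (by positivity), Real.sqrt_one, mul_one]
    have h1 : 1 ≤ (1 - θ)⁻¹ := (one_le_inv₀ (by linarith)).2 (by linarith)
    calc _ ≤ ∑' G, attachmentProcess m (m * j) G * ENNReal.ofReal (((1 - θ)⁻¹) ^ (2 * m)) := by
          refine ENNReal.tsum_le_tsum fun G => ?_
          by_cases hG : attachmentProcess m (m * j) G = 0
          · simp [hG]
          gcongr
          obtain ⟨k, rfl⟩ : ∃ k, j = k + 1 := ⟨j - 1, by omega⟩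
          refine (degree_le_of_mem_support_attachmentProcess hm
            ((PMF.mem_support_iff _ _).2 hG)).trans_eq ?_
          rw [mul_add_one, Nat.add_sub_cancel_left]
      _ = _ := by rw [ENNReal.tsum_mul_right, PMF.tsum_coe, one_mul]
  | succ i hi ih =>
    refine le_trans (tsum_attachmentProcess_succ_le ?_ ?_ ?_) ih
    · rw [Nat.lt_succ_iff, Nat.le_div_iff_mul_le hm, mul_comm]
      exact hi
    · have : √((m * j : ℕ) / (i + 1 : ℕ)) ≤ 1 := by
        rw [Real.sqrt_le_one, div_le_one (by positivity)]
        exact_mod_cast hi.trans (Nat.le_succ i)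
      have h0 := Real.sqrt_nonneg (((m * j : ℕ) : ℝ) / (i + 1 : ℕ))
      refine (one_le_inv₀ ?_).2 ?_ <;> nlinarith
    · have hi0 : (0 : ℝ) < i := by exact_mod_cast hmj.trans_le hi
      rw [div_eq_mul_one_div (_ - 1)]
      refine inv_one_sub_mul_le (by positivity) (by positivity) ?_ ?_
      · have : √((m * j : ℕ) / i) ≤ 1 := by
          rw [Real.sqrt_le_one, div_le_one hi0]
          exact_mod_cast hi
        nlinarith
      · rw [mul_assoc]
        gcongr
        have := sqrt_div_step (a := (m * j : ℕ)) (by positivity) hi0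
        exact_mod_cast this

/-- The tail bound for the degree of a vertex, of the type of a negative binomial distribution with
success probability `√(j / n)`. -/
theorem toOuterMeasure_lt_degree_le {m n j : ℕ} (hm : 1 ≤ m) (hj : 1 ≤ j) (hjn : j ≤ n) {θ : ℝ}
    (hθ0 : 0 ≤ θ) (hθ : θ < 1) (k : ℝ) :
    (prefAttachGraph m n).toOuterMeasure {G | k < G.degree j} ≤
      ENNReal.ofReal (((1 - θ)⁻¹) ^ (2 * m) * (1 - θ * √(j / n)) ^ k) := by
  have hn : (0 : ℝ) < n := by exact_mod_cast hj.trans hjn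
  have hs : √((j : ℝ) / n) ≤ 1 := by
    rw [Real.sqrt_le_one, div_le_one hn]
    exact_mod_cast hjn
  have hs0 := Real.sqrt_nonneg ((j : ℝ) / n)
  have hpos : 0 < 1 - θ * √((j : ℝ) / n) := by nlinarith
  set u := (1 - θ * √((j : ℝ) / n))⁻¹ with hu
  have hu1 : 1 ≤ u := (one_le_inv₀ hpos).2 (by nlinarith)
  have hu0 : 0 < u := by linarith
  have h1 : ((m * j : ℕ) : ℝ) / (m * n : ℕ) = j / n := by
    have : (m : ℝ) ≠ 0 := by positivity
    push_cast
    exact mul_div_mul_left _ _ this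
  have h2 := tsum_attachmentProcess_mul_pow_degree_le hm hj hθ0 hθ (Nat.mul_le_mul_left m hjn)
  rw [h1, ← hu] at h2
  have h3 := (prefAttachGraph m n).toOuterMeasure_le_mul_le
    (fun G => ENNReal.ofReal (u ^ G.degree j)) (ENNReal.ofReal (u ^ k))
  have h4 : (1 - θ * √((j : ℝ) / n)) ^ k = (u ^ k)⁻¹ := by
    rw [hu, Real.inv_rpow hpos.le, inv_inv]
  rw [h4, ← div_eq_mul_inv, ENNReal.ofReal_div_of_pos (by positivity)]
  rw [ENNReal.le_div_iff_mul_le (by simp [Real.rpow_pos_of_pos hu0]) (by simp)]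
  refine le_trans ?_ (h3.trans h2)
  gcongr
  intro hG
  refine ENNReal.ofReal_le_ofReal ?_
  rw [← Real.rpow_natCast]
  exact Real.rpow_le_rpow_of_exponent_le hu1 (le_of_lt hG)

/-! ### The root `z(σ)` and its asymptotics -/

theorem strictMonoOn_mul_log_add_one_sub :
    StrictMonoOn (fun z : ℝ => z * Real.log z + 1 - z) (Set.Ici 1) := by
  refine strictMonoOn_of_deriv_pos (convex_Ici 1) ?_ ?_
  · exact ((Real.continuous_mul_log.add continuous_const).sub continuous_id).continuousOn
  · intro x hx
    rw [interior_Ici, Set.mem_Ioi] at hx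
    have h := ((Real.hasDerivAt_mul_log (by linarith : x ≠ 0)).add_const 1).sub (hasDerivAt_id x)
    have h' : HasDerivAt (fun z : ℝ => z * Real.log z + 1 - z) (Real.log x + 1 - 1) x := h
    rw [h'.deriv]
    have := Real.log_pos hx
    linarith

theorem mul_log_add_one_sub_pos {z : ℝ} (hz : 1 < z) : 0 < z * Real.log z + 1 - z := by
  have := strictMonoOn_mul_log_add_one_sub Set.self_mem_Ici hz.le hz
  simpa using this

theorem existsUnique_phi_eq {c : ℝ} (hc : 0 < c) : ∃! z : ℝ, 1 < z ∧ c = phi z := by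
  have hex : ∃ z : ℝ, 1 < z ∧ c⁻¹ = z * Real.log z + 1 - z := by
    have h0 : 0 < c⁻¹ := inv_pos.2 hc
    -- At `z = exp b` the function equals `(b-1) exp b + 1`, which exceeds `c⁻¹` for `b = c⁻¹ + 2`.
    have hb : (1 : ℝ) ≤ Real.exp (c⁻¹ + 2) := Real.one_le_exp (by linarith)
    have hcont : ContinuousOn (fun z : ℝ => z * Real.log z + 1 - z)
        (Set.Icc 1 (Real.exp (c⁻¹ + 2))) :=
      ((Real.continuous_mul_log.add continuous_const).sub continuous_id).continuousOn
    obtain ⟨z, hz, hzc⟩ := intermediate_value_Icc hb hcont (show c⁻¹ ∈ Set.Icc _ _ from by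
      refine ⟨by simpa using h0.le, ?_⟩
      simp only [Real.log_exp]
      nlinarith)
    refine ⟨z, lt_of_le_of_ne hz.1 ?_, hzc.symm⟩
    rintro rfl
    simp at hzc
    linarith
  obtain ⟨z, hz, hzc⟩ := hex
  refine ⟨z, ⟨hz, by rw [phi, ← hzc, inv_inv]⟩, ?_⟩
  rintro y ⟨hy, hyc⟩
  refine strictMonoOn_mul_log_add_one_sub.injOn hy.le hz.le ?_
  show y * Real.log y + 1 - y = z * Real.log z + 1 - z
  rw [← hzc, hyc, phi, inv_inv]

theorem rpow_neg_half_sub_one_pos {σ : ℝ} (hσ : σ ∈ Set.Ioo (0 : ℝ) 1) :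
    0 < (1 - σ) ^ (-(1 / 2) : ℝ) - 1 := by
  have := Real.one_lt_rpow_of_pos_of_lt_one_of_neg (by linarith [hσ.2] : 0 < 1 - σ)
    (by linarith [hσ.1]) (by norm_num : (-(1 / 2) : ℝ) < 0)
  linarith

theorem isEquivalent_mul_log_add_one_sub :
    (fun z : ℝ => z * Real.log z + 1 - z) ~[atTop] fun z => z * Real.log z := by
  have h1 : (fun z : ℝ => 1 - z) =o[atTop] fun z => z * Real.log z := by
    have h2 : (fun z : ℝ => z) =o[atTop] fun z => z * Real.log z := by
      have := (isBigO_refl (fun z : ℝ => z) atTop).mul_isLittleO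
        (isLittleO_const_left (c := (1 : ℝ)).2 (Or.inr
          (tendsto_norm_atTop_atTop.comp Real.tendsto_log_atTop)))
      simpa using this
    exact ((isLittleO_const_id_atTop (1 : ℝ)).trans h2).sub h2
  refine (IsEquivalent.refl.add_isLittleO h1).congr_left (Eventually.of_forall fun z => ?_)
  simp only [Pi.add_apply]
  ring

theorem isEquivalent_log_mul_log :
    (fun z : ℝ => Real.log (z * Real.log z)) ~[atTop] fun z => Real.log z := by
  refine (IsEquivalent.refl.add_isLittleO
    (Real.isLittleO_log_id_atTop.comp_tendsto Real.tendsto_log_atTop)).congr_left ?_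
  filter_upwards [eventually_gt_atTop 1] with z hz
  simp [Real.log_mul (by linarith : z ≠ 0) (Real.log_pos hz).ne']

theorem isEquivalent_rpow_neg_half_sub_one :
    (fun σ : ℝ => ((1 - σ) ^ (-(1 / 2) : ℝ) - 1)⁻¹) ~[𝓝[>] 0] fun σ => 2 * σ⁻¹ := by
  have hd : HasDerivAt (fun σ : ℝ => (1 - σ) ^ (-(1 / 2) : ℝ)) (1 / 2) 0 := by
    have := ((hasDerivAt_id (0 : ℝ)).const_sub 1).rpow_const (p := (-(1 / 2) : ℝ))
      (Or.inl (by norm_num))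
    exact this.congr_deriv (by simp)
  have h1 := hd.isLittleO
  have h2 : (fun σ : ℝ => (1 - σ) ^ (-(1 / 2) : ℝ) - 1) ~[𝓝[>] 0] fun σ => σ * (1 / 2) := by
    refine IsLittleO.isEquivalent ?_
    have h3 : (fun σ : ℝ => (1 - σ) ^ (-(1 / 2) : ℝ) - 1 - σ * (1 / 2)) =o[𝓝 0] fun σ => σ := by
      simpa using h1
    have h4 : (fun σ : ℝ => σ) =O[𝓝 0] fun σ => σ * (1 / 2) :=
      IsBigO.of_bound 2 (Eventually.of_forall fun x => by
        rw [norm_mul]; norm_num; linarith [abs_nonneg x])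
    exact (h3.trans_isBigO h4).mono nhdsWithin_le_nhds
  refine h2.inv.congr_right (Eventually.of_forall fun σ => ?_)
  simp [mul_comm]

theorem isEquivalent_of_phi_eq {ζ : ℝ → ℝ}
    (hζ : ∀ σ ∈ Set.Ioo (0 : ℝ) 1, 1 < ζ σ ∧ (1 - σ) ^ (-(1 / 2) : ℝ) - 1 = phi (ζ σ)) :
    ζ ~[𝓝[>] 0] (fun σ : ℝ => 2 * (σ * Real.log (1 / σ))⁻¹) := by
  have hev : ∀ᶠ σ : ℝ in 𝓝[>] 0, σ ∈ Set.Ioo (0 : ℝ) 1 := Ioo_mem_nhdsGT one_pos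
  have hinv : Tendsto (fun σ : ℝ => 2 * σ⁻¹) (𝓝[>] 0) atTop :=
    tendsto_inv_nhdsGT_zero.const_mul_atTop two_pos
  have hA : (fun σ => ζ σ * Real.log (ζ σ) + 1 - ζ σ) ~[𝓝[>] 0] fun σ => 2 * σ⁻¹ := by
    refine isEquivalent_rpow_neg_half_sub_one.congr_left ?_
    filter_upwards [hev] with σ hσ
    rw [(hζ σ hσ).2, phi, inv_inv]
  have hAtop : Tendsto (fun σ => ζ σ * Real.log (ζ σ) + 1 - ζ σ) (𝓝[>] 0) atTop :=
    hA.symm.tendsto_atTop hinv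
  have hζtop : Tendsto ζ (𝓝[>] 0) atTop := by
    rw [tendsto_atTop]
    intro b
    filter_upwards [hAtop.eventually_gt_atTop
      (max b 1 * Real.log (max b 1) + 1 - max b 1), hev] with σ h1 hσ
    by_contra! hlt
    have h2 : ζ σ ≤ max b 1 := hlt.le.trans (le_max_left _ _)
    have := strictMonoOn_mul_log_add_one_sub.monotoneOn (hζ σ hσ).1.le (le_max_right b 1) h2
    exact absurd h1 (not_lt.2 this)
  have h1 : (fun σ => ζ σ * Real.log (ζ σ)) ~[𝓝[>] 0] fun σ => 2 * σ⁻¹ :=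
    (isEquivalent_mul_log_add_one_sub.comp_tendsto hζtop).symm.trans hA
  -- Taking logarithms in `ζ log ζ ~ 2/σ` gives the size of `log ζ`, by which `h1` is then divided.
  have h2 : (fun σ => Real.log (ζ σ)) ~[𝓝[>] 0] fun σ => Real.log (1 / σ) := by
    have h3 : (fun σ => Real.log (ζ σ * Real.log (ζ σ))) ~[𝓝[>] 0]
        fun σ => Real.log (2 * σ⁻¹) := h1.log hinv
    have h4 : (fun σ : ℝ => Real.log (2 * σ⁻¹)) ~[𝓝[>] 0] fun σ => Real.log (1 / σ) := by
      have h5 : Tendsto (fun σ : ℝ => Real.log (1 / σ)) (𝓝[>] 0) atTop := by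
        simpa [Function.comp_def] using Real.tendsto_log_atTop.comp tendsto_inv_nhdsGT_zero
      have h6 := (IsEquivalent.refl (u := fun σ : ℝ => Real.log (1 / σ))
        (l := 𝓝[>] 0)).const_add_of_norm_tendsto_atTop (c := Real.log 2)
        (tendsto_norm_atTop_atTop.comp h5)
      refine h6.congr_left ?_
      filter_upwards [hev] with σ hσ
      rw [Real.log_mul two_ne_zero (inv_ne_zero hσ.1.ne'), one_div]
    exact ((isEquivalent_log_mul_log.comp_tendsto hζtop).symm.trans h3).trans h4
  refine ((h1.div h2).congr_left ?_).congr_right ?_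
  · filter_upwards [hev] with σ hσ
    exact mul_div_cancel_right₀ _ (Real.log_pos (hζ σ hσ).1).ne'
  · exact Eventually.of_forall fun σ => by
      simp only [mul_inv, Pi.div_apply, div_eq_mul_inv]; ring

/-! ### Analysis of the rate -/

/-- The first two terms of the series of `-log(1-r)` at `r = 1 - z⁻¹`. -/
theorem sq_half_add_le_log {z : ℝ} (hz : 1 < z) :
    (1 - z⁻¹) + (1 - z⁻¹) ^ 2 / 2 ≤ Real.log z := by
  have h0 : 0 < z⁻¹ := by positivity
  have h1 : z⁻¹ < 1 := inv_lt_one_of_one_lt₀ hz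
  have h := Real.hasSum_pow_div_log_of_abs_lt_one (x := 1 - z⁻¹)
    (by rw [abs_lt]; constructor <;> linarith)
  rw [sub_sub_cancel, Real.log_inv, neg_neg] at h
  have h2 := sum_le_hasSum (Finset.range 2) (fun i _ => by
    have : 0 ≤ 1 - z⁻¹ := by linarith
    positivity) h
  simp only [Finset.sum_range_succ, Finset.sum_range_zero] at h2
  norm_num at h2 ⊢
  linarith

/-- The Poisson large deviation rate is dominated by the geometric one. -/
theorem one_le_mul_phi_mul_log {z : ℝ} (hz : 1 < z) :
    1 ≤ z * phi z * Real.log (1 + (phi z)⁻¹) := by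
  have hA := mul_log_add_one_sub_pos hz
  have hz0 : 0 < z := by linarith
  rw [phi, inv_inv]
  set A := z * Real.log z + 1 - z with hAdef
  have hl := sq_half_add_le_log hz
  set r := 1 - z⁻¹ with hr
  have hr0 : 0 ≤ r := by
    have : z⁻¹ < 1 := inv_lt_one_of_one_lt₀ hz
    linarith
  have hzr : z * r = z - 1 := by rw [hr]; field_simp
  have hAr : A / z = Real.log z - r := by
    rw [hAdef, hr]; field_simp; ring
  have hexp : Real.exp (-r) ≤ 1 - r + r ^ 2 / 2 := by
    have h1 := Real.quadratic_le_exp_of_nonneg hr0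
    rw [Real.exp_neg, inv_le_iff_one_le_mul₀ (Real.exp_pos r)]
    have h2 : 0 ≤ 1 - r + r ^ 2 / 2 := by nlinarith [sq_nonneg (r - 1)]
    calc (1 : ℝ) ≤ (1 - r + r ^ 2 / 2) * (1 + r + r ^ 2 / 2) := by nlinarith [sq_nonneg (r ^ 2)]
      _ ≤ _ := by gcongr
  -- Exponentiated, this is `z * exp(-r) ≤ 1 + A`. The second-order bounds on `exp` and `log`
  -- separate the two sides by the common value `1 + z r²/2`.
  have hkey : A / z ≤ Real.log (1 + A) := by
    rw [Real.le_log_iff_exp_le (by linarith), hAr, sub_eq_add_neg, Real.exp_add,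
      Real.exp_log hz0]
    have h3 : z * (r + r ^ 2 / 2) ≤ z * Real.log z := by gcongr
    calc z * Real.exp (-r) ≤ z * (1 - r + r ^ 2 / 2) := by gcongr
      _ ≤ 1 + A := by rw [hAdef]; nlinarith
  calc (1 : ℝ) = z * A⁻¹ * (A / z) := by field_simp
    _ ≤ _ := by gcongr

/-- The exponent in the tail bound at relative position `x = √(j / n)`. -/
def rate (θ x : ℝ) : ℝ := (1 - x) / x * -Real.log (1 - θ * x)

/-- A product of two nonnegative decreasing factors: `(1-x)/(1-θx)`, and `θ` times the slope of the
secant of `t log t` between `1-θx` and `1`, monotone by convexity. -/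
theorem rate_anti {θ x y : ℝ} (hθ0 : 0 < θ) (hθ : θ < 1) (hx : 0 < x) (hxy : x ≤ y)
    (hy : y < 1) : rate θ y ≤ rate θ x := by
  have hconv : ∀ x, 0 < x → x ≤ y → (1 - θ * y) * -Real.log (1 - θ * y) / y ≤
      (1 - θ * x) * -Real.log (1 - θ * x) / x := by
    intro x hx hxy
    rcases hxy.eq_or_lt with rfl | hlt
    · rfl
    have h := Real.convexOn_mul_log.secant_mono (a := 1) (x := 1 - θ * y) (y := 1 - θ * x)
      (by simp) (by simp only [Set.mem_Ici]; nlinarith) (by simp only [Set.mem_Ici]; nlinarith)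
      (by nlinarith [mul_pos hθ0 (hx.trans hlt)]) (by nlinarith [mul_pos hθ0 hx]) (by nlinarith)
    simp only [Real.log_one, mul_zero, sub_zero] at h
    have e : ∀ t : ℝ, 0 < t → (1 - θ * t) * Real.log (1 - θ * t) / (1 - θ * t - 1) =
        θ⁻¹ * ((1 - θ * t) * -Real.log (1 - θ * t) / t) := by
      intro t ht
      rw [show 1 - θ * t - 1 = -(θ * t) by ring]
      field_simp
    rw [e _ hx, e _ (hx.trans hlt)] at h
    exact le_of_mul_le_mul_left h (by positivity)
  have hy0 : 0 < y := hx.trans_le hxy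
  have hty : 0 < 1 - θ * y := by nlinarith
  have htx : 0 < 1 - θ * x := by nlinarith
  have e : ∀ t : ℝ, 1 - θ * t ≠ 0 →
      rate θ t = ((1 - t) / (1 - θ * t)) * ((1 - θ * t) * -Real.log (1 - θ * t) / t) := by
    intro t ht
    rw [rate]
    generalize 1 - θ * t = b at ht ⊢
    field_simp
  rw [e _ htx.ne', e _ hty.ne']
  have hlog : 0 ≤ -Real.log (1 - θ * y) := by
    have := Real.log_nonpos hty.le (by nlinarith)
    linarith
  refine mul_le_mul ?_ (hconv x hx hxy) (by positivity) ?_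
  · rw [div_le_div_iff₀ hty htx]
    nlinarith
  · exact div_nonneg (by linarith) htx.le

/-- The tail bound has the prefactor `(1-θ)^(-2m)`, so `θ = 1` is not allowed; continuity in `θ`
leaves room below 1. -/
theorem exists_rate_gt {x₀ z : ℝ} (hx₁ : x₀ < 1) (h : 1 < z * rate 1 x₀) :
    ∃ θ δ : ℝ, 0 < θ ∧ θ < 1 ∧ 0 < δ ∧ 1 + δ ≤ z * rate θ x₀ := by
  have hc : ContinuousAt (fun θ => z * rate θ x₀) 1 := by
    unfold rate
    have : (1 - 1 * x₀) ≠ 0 := by linarith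
    fun_prop (disch := assumption)
  have h1 : ∀ᶠ θ in 𝓝[<] (1 : ℝ), 1 < z * rate θ x₀ :=
    (hc.eventually_const_lt h).filter_mono nhdsWithin_le_nhds
  obtain ⟨θ, hθ, hθI⟩ := (h1.and (Ioo_mem_nhdsLT (zero_lt_one (α := ℝ)))).exists
  exact ⟨θ, z * rate θ x₀ - 1, hθI.1, hθI.2, by linarith, by linarith⟩

/-- With `x = √(1-σ)` the equation reads `phi z₀ = (1-x)/x`, so `1 + 1/phi z₀ = 1/(1-x)` and
`one_le_mul_phi_mul_log` becomes `1 ≤ z₀ * rate 1 x`. -/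
theorem one_lt_mul_rate {σ z₀ z : ℝ} (hσ : σ ∈ Set.Ioo (0 : ℝ) 1) (hz₀ : 1 < z₀) (hz : z₀ < z)
    (h : (1 - σ) ^ (-(1 / 2) : ℝ) - 1 = phi z₀) : 1 < z * rate 1 √(1 - σ) := by
  have hs0 : 0 < 1 - σ := by linarith [hσ.2]
  have hx0 : 0 < √(1 - σ) := Real.sqrt_pos.2 hs0
  have hx1 : √(1 - σ) < 1 := by rw [Real.sqrt_lt' one_pos]; linarith [hσ.1]
  rw [Real.rpow_neg hs0.le, ← Real.sqrt_eq_rpow] at h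
  set x := √(1 - σ)
  have hphi : phi z₀ = (1 - x) / x := by rw [← h]; field_simp
  have h1 := one_le_mul_phi_mul_log hz₀
  have h2 : 1 + (phi z₀)⁻¹ = (1 - x)⁻¹ := by
    have : 1 - x ≠ 0 := by linarith
    rw [hphi]; field_simp; ring
  rw [h2, hphi, Real.log_inv, mul_assoc] at h1
  have h3 : rate 1 x = (1 - x) / x * -Real.log (1 - x) := by rw [rate, one_mul]
  rw [← h3] at h1
  have h4 : 0 < rate 1 x := by
    by_contra! hn
    nlinarith
  nlinarith

/-! ### Union bound and the limit statements -/

theorem toOuterMeasure_degree_gt_le {m n j : ℕ} (hm : 1 ≤ m) (hj : 1 ≤ j) {σ θ δ z : ℝ}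
    (hσ : σ ∈ Set.Ioo (0 : ℝ) 1) (hjn : (j : ℝ) ≤ (1 - σ) * n) (hz : 0 ≤ z) (hθ0 : 0 < θ)
    (hθ : θ < 1) (hrate : 1 + δ ≤ z * rate θ √(1 - σ)) :
    (prefAttachGraph m n).toOuterMeasure
        {G | z * (((n : ℝ) / j) ^ (1 / 2 : ℝ) - 1) * Real.log n < G.degree j} ≤
      ENNReal.ofReal (((1 - θ)⁻¹) ^ (2 * m) * (n : ℝ) ^ (-(1 + δ))) := by
  have hj0 : (0 : ℝ) < j := by exact_mod_cast hj
  have hs : 0 < 1 - σ := by linarith [hσ.2]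
  have hn0 : (0 : ℝ) < n := by
    by_contra! h
    nlinarith
  have hjn' : j ≤ n := by
    have : (j : ℝ) ≤ n := by nlinarith [hσ.1]
    exact_mod_cast this
  have hn1 : (1 : ℝ) ≤ n := by exact_mod_cast hj.trans hjn'
  refine (toOuterMeasure_lt_degree_le hm hj hjn' hθ0.le hθ _).trans ?_
  refine ENNReal.ofReal_le_ofReal ?_
  have hx0 : 0 < √((j : ℝ) / n) := Real.sqrt_pos.2 (by positivity)
  have hxx : √((j : ℝ) / n) ≤ √(1 - σ) := Real.sqrt_le_sqrt ((div_le_iff₀ hn0).2 hjn)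
  have hx1 : √(1 - σ) < 1 := by rw [Real.sqrt_lt' one_pos]; linarith [hσ.1]
  have hinv : ((n : ℝ) / j) ^ (1 / 2 : ℝ) = (√((j : ℝ) / n))⁻¹ := by
    rw [← Real.sqrt_eq_rpow, ← Real.sqrt_inv, inv_div]
  rw [hinv]
  set x := √((j : ℝ) / n)
  have hr : 1 + δ ≤ z * rate θ x :=
    hrate.trans (by gcongr; exact rate_anti hθ0 hθ hx0 hxx hx1)
  have hpos : 0 < 1 - θ * x := by nlinarith
  have h1θ : 0 < 1 - θ := by linarith
  gcongr
  rw [Real.rpow_def_of_pos hpos, Real.rpow_def_of_pos hn0]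
  refine Real.exp_le_exp.2 ?_
  have e : Real.log (1 - θ * x) * (z * (x⁻¹ - 1) * Real.log n) =
      Real.log n * -(z * rate θ x) := by
    rw [rate]
    field_simp
  rw [e]
  have := Real.log_nonneg hn1
  gcongr

theorem tendsto_toOuterMeasure_degree_le {m : ℕ} (hm : 1 ≤ m) {a σ z₀ z : ℝ} (ha : 0 < a)
    (hσ : σ ∈ Set.Ioo (0 : ℝ) 1) (hz₀ : 1 < z₀) (hz : z₀ < z)
    (h : (1 - σ) ^ (-(1 / 2) : ℝ) - 1 = phi z₀) :
    Tendsto (fun n : ℕ => (prefAttachGraph m n).toOuterMeasure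
      {G | ∀ j : ℕ, ⌊(n : ℝ) ^ a⌋₊ ≤ j → (j : ℝ) ≤ (1 - σ) * n →
        (G.degree j : ℝ) ≤ z * (((n : ℝ) / j) ^ (1 / 2 : ℝ) - 1) * Real.log n})
      atTop (𝓝 1) := by
  have hs : 0 < 1 - σ := by linarith [hσ.2]
  obtain ⟨θ, δ, hθ0, hθ, hδ, hrate⟩ := exists_rate_gt (x₀ := √(1 - σ))
    (by rw [Real.sqrt_lt' one_pos]; linarith [hσ.1]) (one_lt_mul_rate hσ hz₀ hz h)
  have hlim : Tendsto (fun n : ℕ => ENNReal.ofReal (((1 - θ)⁻¹) ^ (2 * m) * (n : ℝ) ^ (-δ)))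
      atTop (𝓝 0) := by
    have h1 := ((tendsto_rpow_neg_atTop hδ).comp tendsto_natCast_atTop_atTop).const_mul
      (((1 - θ)⁻¹) ^ (2 * m))
    rw [mul_zero] at h1
    simpa using ENNReal.tendsto_ofReal h1
  have hlim' : Tendsto (fun n : ℕ =>
      1 - ENNReal.ofReal (((1 - θ)⁻¹) ^ (2 * m) * (n : ℝ) ^ (-δ))) atTop (𝓝 1) := by
    simpa using ENNReal.Tendsto.sub tendsto_const_nhds hlim (Or.inl ENNReal.one_ne_top)
  refine tendsto_of_tendsto_of_tendsto_of_le_of_le' hlim' tendsto_const_nhds ?_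
    (Eventually.of_forall fun n => PMF.toOuterMeasure_le_one _ _)
  filter_upwards [eventually_ge_atTop 1] with n hn
  refine le_trans (tsub_le_tsub_left ?_ 1) (PMF.one_sub_toOuterMeasure_compl_le _ _)
  have hn1 : (1 : ℝ) ≤ n := by exact_mod_cast hn
  have hn0 : (0 : ℝ) < n := by linarith
  set s : Finset ℕ := (Finset.Icc 1 n).filter fun j => (j : ℝ) ≤ (1 - σ) * n
  calc _ ≤ (prefAttachGraph m n).toOuterMeasure (⋃ j ∈ s,
        {G | z * (((n : ℝ) / j) ^ (1 / 2 : ℝ) - 1) * Real.log n < G.degree j}) := by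
        refine MeasureTheory.measure_mono fun G hG => ?_
        simp only [Set.mem_compl_iff, Set.mem_ofPred_eq, not_forall, not_le] at hG
        obtain ⟨j, hj1, hj2, hG⟩ := hG
        refine Set.mem_biUnion (x := j) ?_ hG
        -- The lower cutoff keeps out `j = 0`, which is not a vertex.
        have h1 : 1 ≤ ⌊(n : ℝ) ^ a⌋₊ := (Nat.one_le_floor_iff _).2 (Real.one_le_rpow hn1 ha.le)
        have h2 : (j : ℝ) ≤ n := by nlinarith [hσ.1]
        simp only [s, Finset.coe_filter, Finset.mem_Icc, Set.mem_ofPred_eq]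
        exact ⟨⟨h1.trans hj1, by exact_mod_cast h2⟩, hj2⟩
    _ ≤ ∑ j ∈ s, (prefAttachGraph m n).toOuterMeasure
        {G | z * (((n : ℝ) / j) ^ (1 / 2 : ℝ) - 1) * Real.log n < G.degree j} :=
        MeasureTheory.measure_biUnion_finset_le _ _
    _ ≤ ∑ j ∈ s, ENNReal.ofReal (((1 - θ)⁻¹) ^ (2 * m) * (n : ℝ) ^ (-(1 + δ))) := by
        refine Finset.sum_le_sum fun j hj => ?_
        simp only [s, Finset.mem_filter, Finset.mem_Icc] at hj
        exact toOuterMeasure_degree_gt_le hm hj.1.1 hσ hj.2 (by linarith) hθ0 hθ hrate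
    _ ≤ n * ENNReal.ofReal (((1 - θ)⁻¹) ^ (2 * m) * (n : ℝ) ^ (-(1 + δ))) := by
        rw [Finset.sum_const, nsmul_eq_mul]
        gcongr
        simpa using Finset.card_filter_le (Finset.Icc 1 n) fun j => (j : ℝ) ≤ (1 - σ) * n
    _ = ENNReal.ofReal (((1 - θ)⁻¹) ^ (2 * m) * (n : ℝ) ^ (-δ)) := by
        rw [← ENNReal.ofReal_natCast, ← ENNReal.ofReal_mul hn0.le]
        congr 1
        rw [neg_add, Real.rpow_add hn0, Real.rpow_neg_one]
        field_simp

theorem tendsto_toOuterMeasure_degree_le_const_mul_log {ε σ z₀ z : ℝ}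
    (hε : ε ∈ Set.Ioo (0 : ℝ) 1) (hσ : σ ∈ Set.Ioo (0 : ℝ) 1) (hz₀ : 1 < z₀) (hz : z₀ < z)
    (h : (1 - σ) ^ (-(1 / 2) : ℝ) - 1 = phi z₀) {m : ℕ} (hm : 1 ≤ m) :
    Tendsto (fun n : ℕ => (prefAttachGraph m n).toOuterMeasure
      {G | ∀ j : ℕ, ε * n ≤ (j : ℝ) → (j : ℝ) ≤ (1 - σ) * n →
        (G.degree j : ℝ) ≤ z * ε⁻¹ ^ (1 / 2 : ℝ) * Real.log n}) atTop (𝓝 1) := by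
  -- Any exponent in `(0,1)` would serve: `n^a ≤ εn` eventually, and `(n/j)^(1/2) ≤ ε^(-1/2)` in the
  -- bulk.
  have hlim := tendsto_toOuterMeasure_degree_le hm one_half_pos hσ hz₀ hz h
  refine tendsto_of_tendsto_of_tendsto_of_le_of_le' hlim tendsto_const_nhds ?_
    (Eventually.of_forall fun n => PMF.toOuterMeasure_le_one _ _)
  have hev : ∀ᶠ n : ℕ in atTop, (n : ℝ) ^ (1 / 2 : ℝ) ≤ ε * n := by
    have h1 := (tendsto_rpow_neg_atTop (one_half_pos (α := ℝ))).comp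
      tendsto_natCast_atTop_atTop
    filter_upwards [h1.eventually_le_const hε.1, eventually_ge_atTop 1] with n hn hn1
    have hn0 : (0 : ℝ) < n := by exact_mod_cast hn1
    calc (n : ℝ) ^ (1 / 2 : ℝ) = (n : ℝ) ^ (-(1 / 2) : ℝ) * n := by
          rw [← Real.rpow_add_one hn0.ne']; norm_num
      _ ≤ ε * n := by gcongr; exact hn
  filter_upwards [hev, eventually_ge_atTop 1] with n hn hn1
  refine MeasureTheory.measure_mono fun G hG j hj1 hj2 => ?_
  have hn1' : (1 : ℝ) ≤ n := by exact_mod_cast hn1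
  have hε0 := hε.1
  have hj0 : (0 : ℝ) < j := lt_of_lt_of_le (by positivity) hj1
  refine (hG j (Nat.floor_le_of_le (hn.trans hj1)) hj2).trans ?_
  have hlog := Real.log_nonneg hn1'
  have hz0 : 0 ≤ z := by linarith
  gcongr
  refine (sub_le_self _ zero_le_one).trans ?_
  gcongr
  rw [div_le_iff₀ hj0, inv_mul_eq_div, le_div_iff₀ hε0, mul_comm]
  exact hj1

end

theorem mainTheorem2 :
    ∃ ζ : ℝ → ℝ,
      -- `ζ σ` is the unique root in `(1, ∞)`
      (∀ σ ∈ Set.Ioo (0 : ℝ) 1, ∀ z : ℝ,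
        (1 < z ∧ (1 - σ) ^ (-(1 / 2) : ℝ) - 1 = phi z) ↔ z = ζ σ) ∧
      -- its asymptotics as `σ` decreases to `0`
      ζ ~[𝓝[>] 0] (fun σ : ℝ => 2 * (σ * Real.log (1 / σ))⁻¹) ∧
      -- the uniform degree bound, with high probability
      (∀ m : ℕ, 1 ≤ m → ∀ a : ℝ, 0 < a → a < (m : ℝ) / (m + 2) →
        ∀ σ ∈ Set.Ioo (0 : ℝ) 1, ∀ z : ℝ, ζ σ < z →
          Tendsto (fun n : ℕ => (prefAttachGraph m n).toOuterMeasure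
            {G | ∀ j : ℕ, ⌊(n : ℝ) ^ a⌋₊ ≤ j → (j : ℝ) ≤ (1 - σ) * n →
              (G.degree j : ℝ) ≤ z * (((n : ℝ) / j) ^ (1 / 2 : ℝ) - 1) * Real.log n})
            atTop (𝓝 1)) ∧
      -- the vertices in the bulk have degrees `O(log n)`, with high probability
      (∀ ε ∈ Set.Ioo (0 : ℝ) 1, ∀ σ ∈ Set.Ioo (0 : ℝ) 1, ∃ C : ℝ, 0 < C ∧
        ∀ m : ℕ, 1 ≤ m →
          Tendsto (fun n : ℕ => (prefAttachGraph m n).toOuterMeasure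
            {G | ∀ j : ℕ, ε * n ≤ (j : ℝ) → (j : ℝ) ≤ (1 - σ) * n →
              (G.degree j : ℝ) ≤ C * Real.log n})
            atTop (𝓝 1)) := by
  have hex : ∀ σ : ℝ, ∃ ζ : ℝ, σ ∈ Set.Ioo (0 : ℝ) 1 → ∀ z : ℝ,
      (1 < z ∧ (1 - σ) ^ (-(1 / 2) : ℝ) - 1 = phi z) ↔ z = ζ := by
    intro σ
    by_cases hσ : σ ∈ Set.Ioo (0 : ℝ) 1
    · obtain ⟨ζ, hζ, huniq⟩ := existsUnique_phi_eq (rpow_neg_half_sub_one_pos hσ)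
      exact ⟨ζ, fun _ z => ⟨huniq z, fun h => h ▸ hζ⟩⟩
    -- Outside `(0,1)` the value is arbitrary.
    · exact ⟨0, fun h => absurd h hσ⟩
  choose ζ hζ using hex
  have hroot : ∀ σ ∈ Set.Ioo (0 : ℝ) 1,
      1 < ζ σ ∧ (1 - σ) ^ (-(1 / 2) : ℝ) - 1 = phi (ζ σ) := fun σ hσ => (hζ σ hσ _).2 rfl
  refine ⟨ζ, hζ, isEquivalent_of_phi_eq hroot, ?_, ?_⟩
  · intro m hm a ha _ σ hσ z hz
    exact tendsto_toOuterMeasure_degree_le hm ha hσ (hroot σ hσ).1 hz (hroot σ hσ).2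
  · intro ε hε σ hσ
    have h1 := (hroot σ hσ).1
    refine ⟨(ζ σ + 1) * ε⁻¹ ^ (1 / 2 : ℝ),
      mul_pos (by linarith) (Real.rpow_pos_of_pos (inv_pos.2 hε.1) _), fun m hm => ?_⟩
    exact tendsto_toOuterMeasure_degree_le_const_mul_log hε hσ h1 (lt_add_one _)
      (hroot σ hσ).2 hm
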